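/- A \emph{general integrator} (for Hamiltonians $H=H_1+H_2$) is a rule $S$ that assigns to each real $\tau$ a finite sequence $S(\tau)=((j_1,c_1),\dots,(j_n,c_n))$ with $j_l\in\{1,2\}$ and $c_l\in\mathbb R$; it depends only on $\tau$, not on the Hamiltonian. Its number of exponentials is $N_{\exp}(\tau)=n$. For Hermitian $d\times d$ matrices $H_1,H_2$ and a time $t>0$ with scaled time $\|H_1+H_2\|\,t=\tau$ (operator norm), it simulates $e^{-i(H_1+H_2)t}$ by the product $$U_S=e^{-iH_{j_1}c_1t}\,e^{-iH_{j_2}c_2t}\cdots e^{-iH_{j_n}c_nt}$$ (the identity if $n=0$). It has error at most $\epsilon$ on $(H_1,H_2,t)$ if for every unit vector $\psi\in\mathbb C^d$ $$D\!\left(U_S|\psi\rangle\langle\psi|U_S^\dagger,\; e^{-i(H_1+H_2)t}|\psi\rangle\langle\psi|e^{i(H_1+H_2)t}\right)\le\epsilon,\qquad D(\rho,\sigma)=\tfrac12\operatorname{Tr}|\rho-\sigma| .$$ \textbf{Corollary.} Let $\tau>\arcsin(1/4)$ and $t>0$. There is no general integrator $S$ with $N_{\exp}(\tau)<\tau/2\pi$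 that has error at most $1/4$ on $(H_1,H_2,t)$ for all Hamiltonians $H=H_1+H_2$ in all finite dimensions $d$ with $\|H\|\,t=\tau$. This remains true if error at most $1/4$ is required only for those $H$ whose summands $H_1,H_2$ are $1$-sparse (at most one nonzero entry in each row and in each column) and satisfy $\|H_j\|\le\|H\|$ for $j=1,2$. -/

import Mathlib

open scoped Matrix Matrix.Norms.L2Operator MatrixOrder

noncomputable section

/-- A general integrator for Hamiltonians `H = H₁ + H₂`. To each scaled time `τ = ‖H‖ t` it assigns
a finite sequence of pairs `(j, c)`, and each pair stands for one exponential `e^{-i H_j c t}`.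
The sequence depends on `τ` only, not on the Hamiltonian. The two summands are
indexed by `0, 1 : Fin 2`. -/
def GeneralIntegrator : Type := ℝ → List (Fin 2 × ℝ)

/-- The number of exponentials `N_exp` used at scaled time `τ`. -/
def GeneralIntegrator.numExp (S : GeneralIntegrator) (τ : ℝ) : ℕ := (S τ).length

/-- The evolution `e^{-i A s}` generated by the matrix `A` for time `s`. -/
def evolution {d : ℕ} (A : Matrix (Fin d) (Fin d) ℂ) (s : ℝ) : Matrix (Fin d) (Fin d) ℂ :=
  NormedSpace.exp ((-Complex.I * (s : ℂ)) • A)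

/-- The product of exponentials that the integrator uses, at scaled time `τ`, to simulate
`e^{-i (H₁ + H₂) t}`. The product over the empty sequence is the identity. -/
def GeneralIntegrator.simulation {d : ℕ} (S : GeneralIntegrator) (τ t : ℝ)
    (H : Fin 2 → Matrix (Fin d) (Fin d) ℂ) : Matrix (Fin d) (Fin d) ℂ :=
  ((S τ).map fun p => evolution (H p.1) (p.2 * t)).prod

/-- A matrix is 1-sparse if each row and each column has at most one nonzero entry. -/
def IsOneSparse {d : ℕ} (A : Matrix (Fin d) (Fin d) ℂ) : Prop :=
  (∀ i j k, A i j ≠ 0 → A i k ≠ 0 → j = k) ∧ (∀ i j k, A j i ≠ 0 → A k i ≠ 0 → j = k)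

/-- The trace distance `D(ρ, σ) = (1/2) Tr |ρ - σ|`, with `|A| = √(A† A)`. -/
def traceDistance {d : ℕ} (ρ σ : Matrix (Fin d) (Fin d) ℂ) : ℝ :=
  (CFC.abs (ρ - σ)).trace.re / 2

/-- The final state `U |ψ⟩⟨ψ| U†`. -/
def finalState {d : ℕ} (U : Matrix (Fin d) (Fin d) ℂ) (ψ : EuclideanSpace ℂ (Fin d)) :
    Matrix (Fin d) (Fin d) ℂ :=
  U * Matrix.vecMulVec (ψ : Fin d → ℂ) (star (ψ : Fin d → ℂ)) * Uᴴ

/-- The simulation of `e^{-i (H₁ + H₂) t}` by the integrator has trace distance error at most `ε`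
for every (pure, normalized) initial state. -/
def GeneralIntegrator.ErrorLE {d : ℕ} (S : GeneralIntegrator) (ε τ t : ℝ)
    (H : Fin 2 → Matrix (Fin d) (Fin d) ℂ) : Prop :=
  ∀ ψ : EuclideanSpace ℂ (Fin d), ‖ψ‖ = 1 →
    traceDistance (finalState (S.simulation τ t H) ψ)
      (finalState (evolution (H 0 + H 1) t) ψ) ≤ ε

end

/-! Each exponential of a sum of disjoint edges of a path moves an excitation by at most one site,
so `n` exponentials starting from site `0` leave site `n + 1` empty
(`prod_evolution_chainMatrix_mulVec_apply_eq_zero`). The exact evolution does reach that site if the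
couplings are those of the spin operator `J_x` with spin `N/2`, `N = n + 1`: the state stays
spin-coherent and has amplitude of modulus `|sin (s/2)| ^ N` at site `N`
(`evolution_chainMatrix_mulVec_single`), with perfect transfer at `s = π`. The trace distance of the
two final states is at least this modulus.

The scaled norm `s N / 2` of the chain may be less than `τ`; an isolated site with a suitable energy
raises the norm to the required value without affecting the transfer. Splitting the edges by parity
yields the two 1-sparse summands. -/

/-- Weighted Schur test. -/
theorem Matrix.l2_opNorm_le_of_weighted_sum {n : Type*} [Fintype n] [DecidableEq n]
    (A : Matrix n n ℂ) (B : n → n → ℝ) (w : n → ℝ) (c : ℝ) (hc : 0 ≤ c)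
    (hA : ∀ i j, ‖A i j‖ ≤ B i j) (hw : ∀ i, 0 < w i)
    (hrow : ∀ i, ∑ j, B i j * w j ≤ c * w i) (hcol : ∀ j, ∑ i, B i j * w i ≤ c * w j) :
    ‖A‖ ≤ c := by
  have hB : ∀ i j, 0 ≤ B i j := fun i j => (norm_nonneg _).trans (hA i j)
  rw [Matrix.cstar_norm_def]
  refine ContinuousLinearMap.opNorm_le_bound _ hc fun x => ?_
  refine le_of_sq_le_sq ?_ (by positivity)
  rw [mul_pow, EuclideanSpace.norm_sq_eq, EuclideanSpace.norm_sq_eq]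
  have key : ∀ i, ‖(Matrix.toEuclideanCLM (n := n) (𝕜 := ℂ) A x) i‖ ^ 2
      ≤ ∑ j, c * (B i j * w i) * (‖x j‖ ^ 2 / w j) := by
    intro i
    have h1 : ‖(Matrix.toEuclideanCLM (n := n) (𝕜 := ℂ) A x) i‖ ≤ ∑ j, B i j * ‖x j‖ := by
      rw [Matrix.ofLp_toEuclideanCLM, Matrix.mulVec, dotProduct]
      refine (norm_sum_le _ _).trans (Finset.sum_le_sum fun j _ => ?_)
      rw [norm_mul]
      exact mul_le_mul_of_nonneg_right (hA i j) (norm_nonneg _)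
    have h2 : (∑ j, B i j * ‖x j‖) ^ 2
        ≤ (∑ j, B i j * w j) * ∑ j, B i j * (‖x j‖ ^ 2 / w j) := by
      -- Cauchy–Schwarz for the factorization `B x = √(B w) * √(B x² / w)`.
      refine Finset.sum_sq_le_sum_mul_sum_of_sq_le_mul _
        (fun j _ => mul_nonneg (hB i j) (hw j).le)
        (fun j _ => mul_nonneg (hB i j) (div_nonneg (sq_nonneg _) (hw j).le)) fun j _ => le_of_eq ?_
      have := (hw j).ne'
      field_simp
    calc _ ≤ (∑ j, B i j * ‖x j‖) ^ 2 := by gcongr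
      _ ≤ _ := h2
      _ ≤ (c * w i) * ∑ j, B i j * (‖x j‖ ^ 2 / w j) :=
        mul_le_mul_of_nonneg_right (hrow i) (Finset.sum_nonneg fun j _ =>
          mul_nonneg (hB i j) (div_nonneg (sq_nonneg _) (hw j).le))
      _ = _ := by
        rw [Finset.mul_sum]
        exact Finset.sum_congr rfl fun j _ => by ring
  refine (Finset.sum_le_sum fun i _ => key i).trans ?_
  rw [Finset.sum_comm, Finset.mul_sum]
  refine Finset.sum_le_sum fun j _ => ?_
  rw [← Finset.sum_mul, ← Finset.mul_sum]
  have := hw j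
  calc _ ≤ c * (c * w j) * (‖x j‖ ^ 2 / w j) := by gcongr; exact hcol j
    _ = _ := by field_simp

theorem Matrix.norm_apply_le_l2_opNorm {n : Type*} [Fintype n] [DecidableEq n]
    (A : Matrix n n ℂ) (i j : n) : ‖A i j‖ ≤ ‖A‖ := by
  have h := Matrix.l2_opNorm_mulVec A (EuclideanSpace.single j 1)
  refine le_trans ?_ (h.trans (by simp))
  refine le_trans (le_of_eq ?_) (PiLp.norm_apply_le _ i)
  simp

/-- Uniqueness for linear ODEs: an evolution is found by guessing the trajectory and differentiating
it. -/
theorem Matrix.exp_smul_mulVec_of_hasDerivAt {n : Type*} [Fintype n] [DecidableEq n]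
    (A : Matrix n n ℂ) (y : ℝ → n → ℂ) (hy : ∀ u, HasDerivAt y (A *ᵥ y u) u) (u : ℝ) :
    NormedSpace.exp (u • A) *ᵥ y 0 = y u := by
  let T : Matrix n n ℂ →L[ℝ] (n → ℂ) := LinearMap.toContinuousLinearMap
    { toFun := fun M => M *ᵥ y 0
      map_add' := fun M M' => Matrix.add_mulVec M M' _
      map_smul' := fun r M => Matrix.smul_mulVec r M _ }
  have hT : ∀ M, T M = M *ᵥ y 0 := fun _ => rfl
  let G : (n → ℂ) →L[ℝ] (n → ℂ) := LinearMap.toContinuousLinearMap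
    (A.mulVecLin.restrictScalars ℝ)
  have hG : ∀ x, G x = A *ᵥ x := fun _ => rfl
  have hf : ∀ v : ℝ, HasDerivAt (fun v : ℝ => NormedSpace.exp (v • A) *ᵥ y 0)
      (G (NormedSpace.exp (v • A) *ᵥ y 0)) v := by
    intro v
    have := T.hasFDerivAt.comp_hasDerivAt v (hasDerivAt_exp_smul_const' (𝕂 := ℝ) A v)
    rw [hG, Matrix.mulVec_mulVec]
    exact this
  have := ODE_solution_unique_univ (v := fun _ => G) (s := fun _ => Set.univ) (K := ‖G‖₊)
    (t₀ := 0) (f := fun v : ℝ => NormedSpace.exp (v • A) *ᵥ y 0) (g := y)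
    (fun _ => G.lipschitz.lipschitzOnWith) (fun v => ⟨hf v, trivial⟩)
    (fun v => ⟨hy v, trivial⟩) (by simp)
  exact congrFun this u

theorem evolution_mem_unitary {d : ℕ} {A : Matrix (Fin d) (Fin d) ℂ} (hA : A.IsHermitian)
    (s : ℝ) : evolution A s ∈ unitary (Matrix (Fin d) (Fin d) ℂ) := by
  let +nondep : NormedAlgebra ℚ (Matrix (Fin d) (Fin d) ℂ) := .restrictScalars ℚ ℂ _
  refine NormedSpace.exp_mem_unitary_of_mem_skewAdjoint ?_
  rw [skewAdjoint.mem_iff, star_smul]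
  have : star A = A := hA
  rw [this]
  simp [← neg_smul]

theorem norm_toLp_mulVec_of_mem_unitary {d : ℕ} {U : Matrix (Fin d) (Fin d) ℂ}
    (hU : U ∈ unitary (Matrix (Fin d) (Fin d) ℂ)) (x : EuclideanSpace ℂ (Fin d)) :
    ‖WithLp.toLp 2 (U *ᵥ x.ofLp)‖ = ‖x‖ := by
  have hV1 : ∀ V ∈ unitary (Matrix (Fin d) (Fin d) ℂ), ‖V‖ ≤ 1 := by
    intro V hV
    have h : ‖V‖ * ‖V‖ = ‖(1 : Matrix (Fin d) (Fin d) ℂ)‖ := by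
      rw [← CStarRing.norm_star_mul_self, Unitary.star_mul_self_of_mem hV]
    rw [← Matrix.diagonal_one, Matrix.l2_opNorm_diagonal] at h
    have h1 : ‖(fun _ => 1 : Fin d → ℂ)‖ ≤ 1 := (pi_norm_le_iff_of_nonneg zero_le_one).2 (by simp)
    nlinarith [norm_nonneg V]
  have hle : ∀ V ∈ unitary (Matrix (Fin d) (Fin d) ℂ), ∀ z : EuclideanSpace ℂ (Fin d),
      ‖WithLp.toLp 2 (V *ᵥ z.ofLp)‖ ≤ ‖z‖ := by
    intro V hV z
    refine (Matrix.l2_opNorm_mulVec V z).trans ?_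
    exact mul_le_of_le_one_left (norm_nonneg _) (hV1 V hV)
  refine le_antisymm (hle U hU x) ?_
  have := hle (star U) (Unitary.star_mem hU) (WithLp.toLp 2 (U *ᵥ x.ofLp))
  rwa [Matrix.mulVec_mulVec, Unitary.star_mul_self_of_mem hU, Matrix.one_mulVec] at this

/-! ### Trace distance and overlap of pure states -/

/-- Trace distance of pure states. -/
theorem traceDistance_vecMulVec {d : ℕ} (x y : EuclideanSpace ℂ (Fin d)) (hx : ‖x‖ = 1)
    (hy : ‖y‖ = 1) (hxy : ‖inner ℂ x y‖ < 1) :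
    traceDistance (Matrix.vecMulVec x.ofLp (star x.ofLp)) (Matrix.vecMulVec y.ofLp (star y.ofLp))
      = √(1 - ‖inner ℂ x y‖ ^ 2) := by
  set f := inner ℂ x y with hf
  have hdot : ∀ a b : EuclideanSpace ℂ (Fin d), star a.ofLp ⬝ᵥ b.ofLp = inner ℂ a b := by
    intro a b
    rw [EuclideanSpace.inner_eq_star_dotProduct, dotProduct_comm]
  have hself : ∀ a : EuclideanSpace ℂ (Fin d), ‖a‖ = 1 → inner ℂ a a = 1 := by
    intro a ha
    rw [inner_self_eq_norm_sq_to_K, ha]; simp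
  have hyx : inner ℂ y x = star f := by rw [hf]; exact (inner_conj_symm y x).symm
  have hff : f * star f = ((‖f‖ ^ 2 : ℝ) : ℂ) := by
    push_cast
    exact Complex.mul_conj' f
  set F : ℝ := ‖f‖ ^ 2 with hF
  have hF1 : 0 < 1 - F := by
    have := norm_nonneg f
    rw [hF]; nlinarith
  set ρ := Matrix.vecMulVec x.ofLp (star x.ofLp) with hρ
  set σ := Matrix.vecMulVec y.ofLp (star y.ofLp) with hσ
  have hρρ : ρ * ρ = ρ := by
    rw [hρ, Matrix.vecMulVec_mul_vecMulVec, hdot, hself x hx]; simp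
  have hσσ : σ * σ = σ := by
    rw [hσ, Matrix.vecMulVec_mul_vecMulVec, hdot, hself y hy]; simp
  have hρσ : ρ * σ = f • Matrix.vecMulVec x.ofLp (star y.ofLp) := by
    rw [hρ, hσ, Matrix.vecMulVec_mul_vecMulVec, hdot, Matrix.vecMulVec_smul]
  have hσρ : σ * ρ = star f • Matrix.vecMulVec y.ofLp (star x.ofLp) := by
    rw [hρ, hσ, Matrix.vecMulVec_mul_vecMulVec, hdot, hyx, Matrix.vecMulVec_smul]
  have h3 : ρ * σ * ρ = (F : ℂ) • ρ := by
    rw [hρσ, Matrix.smul_mul, hρ, Matrix.vecMulVec_mul_vecMulVec, hdot, hyx,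
      Matrix.vecMulVec_smul, smul_smul, hff]
  have h4 : σ * ρ * σ = (F : ℂ) • σ := by
    rw [hσρ, Matrix.smul_mul, hσ, Matrix.vecMulVec_mul_vecMulVec, hdot,
      Matrix.vecMulVec_smul, smul_smul, mul_comm, hff]
  set A := ρ - σ with hA
  have hAA : A * A = ρ + σ - ρ * σ - σ * ρ := by
    rw [hA, sub_mul, mul_sub, mul_sub, hρρ, hσσ]; abel
  have hA3 : A * (A * A) = (1 - F : ℂ) • A := by
    rw [hAA, hA]
    simp only [sub_mul, mul_sub, mul_add, hρρ, hσσ, ← mul_assoc, h3, h4]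
    simp only [sub_smul, smul_sub, one_smul]
    abel
  have hAs : star A = A := by
    rw [hA, star_sub]
    simp [hρ, hσ, Matrix.star_eq_conjTranspose, Matrix.conjTranspose_vecMulVec]
  have hl : 0 < √(1 - F) := Real.sqrt_pos.2 hF1
  -- As `A ^ 3 = (1 - F) A`, the eigenvalues of `A` lie in `{0, ±√(1 - F)}`, so `|A|` is `A²`
  -- divided by `√(1 - F)`; this needs `F < 1`.
  have habs : CFC.abs A = ((√(1 - F))⁻¹ : ℝ) • (A * A) := by
    have hnn : 0 ≤ ((√(1 - F))⁻¹ : ℝ) • (A * A) := by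
      refine smul_nonneg (inv_nonneg.2 hl.le) ?_
      nth_rewrite 1 [← hAs]
      exact star_mul_self_nonneg A
    refine CFC.sqrt_unique ?_ hnn
    rw [hAs, Matrix.smul_mul, Matrix.mul_smul, smul_smul, mul_assoc, hA3, Matrix.mul_smul,
      ← mul_inv, Real.mul_self_sqrt hF1.le]
    rw [← Complex.coe_smul, smul_smul]
    have : ((1 - F)⁻¹ : ℝ) * (1 - F : ℂ) = 1 := by
      rw [← Complex.ofReal_one, ← Complex.ofReal_sub, ← Complex.ofReal_mul,
        inv_mul_cancel₀ hF1.ne']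
    rw [this, one_smul]
  have htr : (A * A).trace = ((2 * (1 - F) : ℝ) : ℂ) := by
    rw [hAA, Matrix.trace_sub, Matrix.trace_sub, Matrix.trace_add, hρσ, hσρ, Matrix.trace_smul,
      Matrix.trace_smul, hρ, hσ]
    simp only [Matrix.trace_vecMulVec]
    simp only [dotProduct_comm _ (star _), hdot, hself x hx, hself y hy, hyx, ← hf, smul_eq_mul,
      hff]
    rw [mul_comm (star f), hff]
    push_cast; ring
  rw [traceDistance, habs, Matrix.trace_smul, htr, Complex.real_smul, ← Complex.ofReal_mul,
    Complex.ofReal_re]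
  have := Real.mul_self_sqrt hF1.le
  field_simp
  linarith

theorem finalState_eq_vecMulVec {d : ℕ} (U : Matrix (Fin d) (Fin d) ℂ)
    (ψ : EuclideanSpace ℂ (Fin d)) :
    finalState U ψ = Matrix.vecMulVec (U *ᵥ ψ.ofLp) (star (U *ᵥ ψ.ofLp)) := by
  rw [finalState, Matrix.mul_vecMulVec, Matrix.vecMulVec_mul, Matrix.star_mulVec]

/-- If a unit vector has no component at `k` and another one has the component `z` at `k`, then
the squared overlap of the two is at most `1 - ‖z‖²`. -/
theorem norm_inner_sq_le_of_apply_eq_zero {d : ℕ} (x y : EuclideanSpace ℂ (Fin d)) (hx : ‖x‖ = 1)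
    (hy : ‖y‖ = 1) (k : Fin d) (hk : x k = 0) : ‖inner ℂ x y‖ ^ 2 ≤ 1 - ‖y k‖ ^ 2 := by
  have h := norm_inner_le_norm (𝕜 := ℂ) x (y - EuclideanSpace.single k (y k))
  rw [inner_sub_right, EuclideanSpace.inner_single_right, hk, hx, one_mul] at h
  simp only [map_zero, mul_zero, sub_zero] at h
  have h2 : ‖y - EuclideanSpace.single k (y k)‖ ^ 2 = 1 - ‖y k‖ ^ 2 := by
    rw [@norm_sub_sq ℂ, EuclideanSpace.inner_single_right, hy, Complex.mul_conj']
    simp only [PiLp.norm_single]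
    have : RCLike.re ((‖y k‖ : ℂ) ^ 2) = ‖y k‖ ^ 2 := by
      rw [← Complex.ofReal_pow]; exact Complex.ofReal_re _
    rw [this]
    ring
  rw [← h2]
  gcongr

/-! ### The Krawtchouk chain -/

/-- The Krawtchouk coupling between the sites `k` and `k + 1` of a chain with sites `0, …, N`. -/
noncomputable def krawtchoukCoupling (N k : ℕ) : ℝ := √(((N - k : ℕ) : ℝ) * (k + 1)) / 2

theorem krawtchoukCoupling_nonneg (N k : ℕ) : 0 ≤ krawtchoukCoupling N k := by
  unfold krawtchoukCoupling; positivity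

theorem choose_succ_mul_cast (N k : ℕ) :
    (N.choose (k + 1) : ℝ) * (k + 1) = N.choose k * ((N - k : ℕ) : ℝ) := by
  exact_mod_cast Nat.choose_succ_right_eq N k

/-- With the next identity this gives the action of the couplings on binomial weights; the
coefficients `(N - k) / 2` and `k / 2` add up to the eigenvalue `N / 2`. -/
theorem krawtchoukCoupling_mul_sqrt_choose_succ (N k : ℕ) :
    krawtchoukCoupling N k * √(N.choose (k + 1)) = ((N - k : ℕ) : ℝ) / 2 * √(N.choose k) := by
  have h : √(((N - k : ℕ) : ℝ) * (k + 1)) * √(N.choose (k + 1))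
      = ((N - k : ℕ) : ℝ) * √(N.choose k) := by
    have e : ((N - k : ℕ) : ℝ) * (k + 1) * N.choose (k + 1)
        = ((N - k : ℕ) : ℝ) * ((N - k : ℕ) : ℝ) * N.choose k := by
      linear_combination ((N - k : ℕ) : ℝ) * choose_succ_mul_cast N k
    rw [← Real.sqrt_mul (by positivity), e, Real.sqrt_mul (by positivity),
      Real.sqrt_mul_self (by positivity)]
  rw [krawtchoukCoupling]
  linear_combination h / 2

theorem krawtchoukCoupling_mul_sqrt_choose (N k : ℕ) :
    krawtchoukCoupling N k * √(N.choose k) = ((k : ℝ) + 1) / 2 * √(N.choose (k + 1)) := by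
  have h : √(((N - k : ℕ) : ℝ) * (k + 1)) * √(N.choose k)
      = ((k : ℝ) + 1) * √(N.choose (k + 1)) := by
    rw [← Real.sqrt_mul (by positivity), mul_comm, ← mul_assoc, ← choose_succ_mul_cast,
      mul_assoc, mul_comm, Real.sqrt_mul (by positivity), Real.sqrt_mul_self (by positivity)]
  rw [krawtchoukCoupling]
  linear_combination h / 2

/-- Entries of the Krawtchouk chain on the sites `0, …, N`, scaled by `r`, together with the
energy `c` on the isolated site `N + 1`. -/
noncomputable def chainEntry (N : ℕ) (r c : ℝ) (i j : ℕ) : ℝ :=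
  if j = i + 1 ∧ j ≤ N then r * krawtchoukCoupling N i
  else if i = j + 1 ∧ i ≤ N then r * krawtchoukCoupling N j
  else if i = N + 1 ∧ j = N + 1 then c else 0

theorem chainEntry_nonneg (N : ℕ) {r c : ℝ} (hr : 0 ≤ r) (hc : 0 ≤ c) (i j : ℕ) :
    0 ≤ chainEntry N r c i j := by
  have := krawtchoukCoupling_nonneg N
  unfold chainEntry
  split_ifs
  exacts [mul_nonneg hr (this _), mul_nonneg hr (this _), hc, le_rfl]

theorem chainEntry_comm (N : ℕ) (r c : ℝ) (i j : ℕ) :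
    chainEntry N r c i j = chainEntry N r c j i := by
  unfold chainEntry
  split_ifs <;> first | rfl | omega

/-- Stated for a general module so that it serves both the real Schur weights and the complex
amplitudes. -/
theorem sum_chainEntry_smul {E : Type*} [AddCommGroup E] [Module ℝ E] (N : ℕ) (r c : ℝ)
    (y : ℕ → E) (i : ℕ) (hi : i < N + 2) :
    ∑ j ∈ Finset.range (N + 2), chainEntry N r c i j • y j
      = (if i < N then (r * krawtchoukCoupling N i) • y (i + 1) else 0)
        + (if 0 < i ∧ i ≤ N then (r * krawtchoukCoupling N (i - 1)) • y (i - 1) else 0)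
        + (if i = N + 1 then c • y i else 0) := by
  have h : ∀ j, chainEntry N r c i j • y j
      = (if j = i + 1 then (if i < N then (r * krawtchoukCoupling N i) • y (i + 1) else 0) else 0)
        + (if j = i - 1 then
            (if 0 < i ∧ i ≤ N then (r * krawtchoukCoupling N (i - 1)) • y (i - 1) else 0) else 0)
        + (if j = i then (if i = N + 1 then c • y i else 0) else 0) := by
    intro j
    unfold chainEntry
    by_cases h1 : j = i + 1
    · subst h1
      have e1 : i + 1 ≠ i - 1 := by omega
      have e2 : i + 1 ≠ i := by omega
      have e3 : ¬ (i = i + 1 + 1 ∧ i ≤ N) := by omega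
      have e4 : ¬ (i = N + 1 ∧ i + 1 = N + 1) := by omega
      simp only [e1, e2, e3, e4, if_true, if_false, true_and, add_zero, Nat.lt_iff_add_one_le]
      split_ifs <;> simp
    by_cases h2 : i = j + 1
    · subst h2
      have e1 : j ≠ j + 1 := by omega
      have e4 : ¬ (j + 1 = N + 1 ∧ j = N + 1) := by omega
      simp only [h1, e1, e4, if_true, if_false, true_and, false_and, zero_add, add_zero,
        Nat.add_sub_cancel, Nat.succ_pos]
      split_ifs <;> simp
    · simp only [h1, h2, if_false, false_and, zero_add]
      by_cases h3 : j = i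
      · subst h3
        by_cases h4 : j = j - 1
        · have : ¬ (0 < j ∧ j ≤ N) := by omega
          simp only [← h4, this, if_true, if_false, and_self, zero_add]
          split_ifs <;> simp
        · simp only [h4, if_true, if_false, and_self, zero_add]
          split_ifs <;> simp
      · have e4 : ¬ (i = N + 1 ∧ j = N + 1) := by omega
        simp only [h3, e4, if_false, add_zero, zero_smul]
        by_cases h4 : j = i - 1
        · have : ¬ (0 < i ∧ i ≤ N) := by omega
          simp [this]
        · simp [h4]
  simp only [h, Finset.sum_add_distrib, Finset.sum_ite_eq', Finset.mem_range]
  have e1 : i - 1 < N + 2 := by omega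
  simp only [e1, hi, if_true]
  congr 2
  split_ifs <;> first | rfl | omega

/-- The part of the chain that consists of the edges whose left end has the parity `b`. -/
noncomputable def chainMatrix (N : ℕ) (r c : ℝ) (b : Fin 2) :
    Matrix (Fin (N + 2)) (Fin (N + 2)) ℂ :=
  Matrix.of fun i j => if min (i : ℕ) j % 2 = b then (chainEntry N r c i j : ℂ) else 0

theorem chainMatrix_isHermitian (N : ℕ) (r c : ℝ) (b : Fin 2) :
    (chainMatrix N r c b).IsHermitian := by
  ext i j
  simp only [Matrix.conjTranspose_apply, chainMatrix, Matrix.of_apply]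
  rw [min_comm, chainEntry_comm]
  split_ifs <;> simp

theorem chainMatrix_apply_ne_zero {N : ℕ} {r c : ℝ} {b : Fin 2} {i j : Fin (N + 2)}
    (h : chainMatrix N r c b i j ≠ 0) : min (i : ℕ) j % 2 = b ∧
      (((j : ℕ) = i + 1 ∧ (j : ℕ) ≤ N) ∨ ((i : ℕ) = j + 1 ∧ (i : ℕ) ≤ N) ∨
        ((i : ℕ) = N + 1 ∧ (j : ℕ) = N + 1)) := by
  simp only [chainMatrix, Matrix.of_apply, chainEntry] at h
  split_ifs at h with h0 h1 h2 h3
  · exact ⟨h0, .inl h1⟩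
  · exact ⟨h0, .inr (.inl h2)⟩
  · exact ⟨h0, .inr (.inr h3)⟩
  · simp at h
  · simp at h

/-- Edges whose left ends have equal parity share no site, and the isolated site meets no edge. -/
theorem chainMatrix_isOneSparse (N : ℕ) (r c : ℝ) (b : Fin 2) :
    IsOneSparse (chainMatrix N r c b) := by
  constructor <;> intro i j k h1 h2 <;>
  · have h1 := chainMatrix_apply_ne_zero h1
    have h2 := chainMatrix_apply_ne_zero h2
    ext
    omega

theorem chainMatrix_zero_add_one_apply (N : ℕ) (r c : ℝ) (i j : Fin (N + 2)) :
    (chainMatrix N r c 0 + chainMatrix N r c 1) i j = (chainEntry N r c i j : ℂ) := by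
  simp only [Matrix.add_apply, chainMatrix, Matrix.of_apply, Fin.val_zero, Fin.val_one]
  rcases Nat.mod_two_eq_zero_or_one (min (i : ℕ) j) with h | h <;> simp [h]

/-! ### Norms of the chain and of its parts -/

/-- The weights `√(N.choose j)` form the Perron eigenvector of the chain, with eigenvalue `r N / 2`.
The isolated site has weight `1` because its binomial coefficient is zero. -/
theorem sum_chainEntry_mul_sqrt_choose_le (N : ℕ) {r c : ℝ} (hrc : r * N / 2 ≤ c)
    (i : ℕ) (hi : i < N + 2) :
    ∑ j ∈ Finset.range (N + 2), chainEntry N r c i j * (if j ≤ N then √(N.choose j) else 1)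
      ≤ c * (if i ≤ N then √(N.choose i) else 1) := by
  have h := sum_chainEntry_smul N r c (fun j => if j ≤ N then √(N.choose j) else 1) i hi
  simp only [smul_eq_mul] at h
  rw [h]
  rcases Nat.lt_or_ge N i with h1 | h1
  · have : i = N + 1 := by omega
    subst this
    simp
  · have e1 : i ≠ N + 1 := by omega
    have e2 : i - 1 ≤ N := by omega
    simp only [h1, e1, e2, if_true, if_false, add_zero, and_true]
    have f1 : (if i < N then r * krawtchoukCoupling N i *
        (if i + 1 ≤ N then √(N.choose (i + 1)) else 1) else 0)
        = r * ((N - i : ℝ) / 2 * √(N.choose i)) := by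
      split_ifs with h2 h3
      · rw [mul_assoc, krawtchoukCoupling_mul_sqrt_choose_succ, Nat.cast_sub h1]
      · omega
      · have : i = N := by omega
        simp [this]
    have f2 : (if 0 < i then r * krawtchoukCoupling N (i - 1) * √(N.choose (i - 1)) else 0)
        = r * ((i : ℝ) / 2 * √(N.choose i)) := by
      rcases i with _ | i
      · simp
      · simp only [Nat.succ_pos, if_true, Nat.add_sub_cancel]
        rw [mul_assoc, krawtchoukCoupling_mul_sqrt_choose]
        push_cast; rfl
    rw [f1, f2]
    calc _ = r * N / 2 * √(N.choose i) := by ring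
      _ ≤ _ := by gcongr

theorem norm_le_of_norm_apply_le_chainEntry {N : ℕ} {r c : ℝ} (hr : 0 ≤ r)
    (hrc : r * N / 2 ≤ c) (A : Matrix (Fin (N + 2)) (Fin (N + 2)) ℂ)
    (hA : ∀ i j, ‖A i j‖ ≤ chainEntry N r c i j) : ‖A‖ ≤ c := by
  have hc : 0 ≤ c := le_trans (by positivity) hrc
  have hrow : ∀ i : Fin (N + 2), ∑ j : Fin (N + 2), chainEntry N r c i j *
      (if (j : ℕ) ≤ N then √(N.choose j) else 1)
        ≤ c * (if (i : ℕ) ≤ N then √(N.choose i) else 1) := by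
    intro i
    rw [Fin.sum_univ_eq_sum_range
      (fun j => chainEntry N r c i j * (if j ≤ N then √(N.choose j) else 1))]
    exact sum_chainEntry_mul_sqrt_choose_le N hrc i i.2
  refine Matrix.l2_opNorm_le_of_weighted_sum A (fun i j => chainEntry N r c i j)
    (fun i => if (i : ℕ) ≤ N then √(N.choose i) else 1) c hc hA (fun i => ?_) hrow fun j => ?_
  · split_ifs with h
    · exact Real.sqrt_pos.2 (by exact_mod_cast Nat.choose_pos h)
    · exact one_pos
  · simpa only [chainEntry_comm N r c _ j] using hrow j

theorem norm_chainMatrix_le {N : ℕ} {r c : ℝ} (hr : 0 ≤ r) (hrc : r * N / 2 ≤ c) (b : Fin 2) :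
    ‖chainMatrix N r c b‖ ≤ c := by
  have hc : 0 ≤ c := le_trans (by positivity) hrc
  refine norm_le_of_norm_apply_le_chainEntry hr hrc _ fun i j => ?_
  have := chainEntry_nonneg N hr hc i j
  simp only [chainMatrix, Matrix.of_apply]
  split_ifs
  · simp [abs_of_nonneg this]
  · simpa using this

/-- The Schur test gives the upper bound; the diagonal entry `c` of the isolated site attains it. -/
theorem norm_chainMatrix_zero_add_one {N : ℕ} {r c : ℝ} (hr : 0 ≤ r) (hrc : r * N / 2 ≤ c) :
    ‖chainMatrix N r c 0 + chainMatrix N r c 1‖ = c := by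
  have hc : 0 ≤ c := le_trans (by positivity) hrc
  refine le_antisymm (norm_le_of_norm_apply_le_chainEntry hr hrc _ fun i j => ?_) ?_
  · rw [chainMatrix_zero_add_one_apply]
    simp [abs_of_nonneg (chainEntry_nonneg N hr hc i j)]
  · have := Matrix.norm_apply_le_l2_opNorm (chainMatrix N r c 0 + chainMatrix N r c 1)
      (Fin.last (N + 1)) (Fin.last (N + 1))
    rw [chainMatrix_zero_add_one_apply] at this
    simpa [chainEntry, abs_of_nonneg hc] using this

/-! ### Exact evolution along the chain -/

/-- The amplitudes of the spin-coherent state at angle `s`. -/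
noncomputable def coherentAmplitude (N : ℕ) (s : ℝ) (k : ℕ) : ℂ :=
  (√(N.choose k) : ℂ) * ((Real.cos (s / 2) : ℂ) ^ (N - k) *
    (-Complex.I * (Real.sin (s / 2) : ℂ)) ^ k)

theorem hasDerivAt_coherentAmplitude (N k : ℕ) (s : ℝ) :
    HasDerivAt (fun s => coherentAmplitude N s k)
      ((√(N.choose k) : ℂ) * (((N - k : ℕ) : ℂ) * (Real.cos (s / 2) : ℂ) ^ (N - k - 1) *
          (-(Real.sin (s / 2) : ℂ) / 2) * (-Complex.I * (Real.sin (s / 2) : ℂ)) ^ k +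
        (Real.cos (s / 2) : ℂ) ^ (N - k) *
          ((k : ℂ) * (-Complex.I * (Real.sin (s / 2) : ℂ)) ^ (k - 1) *
            (-Complex.I * ((Real.cos (s / 2) : ℂ) / 2))))) s := by
  have hid : HasDerivAt (fun s : ℝ => s / 2) (1 / 2) s := (hasDerivAt_id s).div_const 2
  have hcos := ((Real.hasDerivAt_cos (s / 2)).comp s hid).ofReal_comp
  have hsin := ((Real.hasDerivAt_sin (s / 2)).comp s hid).ofReal_comp
  have h := ((hcos.pow (N - k)).mul ((hsin.const_mul (-Complex.I)).pow k)).const_mul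
    (√(N.choose k) : ℂ)
  refine h.congr_deriv ?_
  simp only [Function.comp_apply, Pi.pow_apply]
  push_cast
  ring

/-- The Schrödinger equation, site by site. It also holds at site `N + 1`, where the amplitude
vanishes with `N.choose (N + 1)`. -/
theorem coherentAmplitude_deriv_eq (N k : ℕ) (s : ℝ) (hk : k < N + 2) (r c : ℝ) :
    (r : ℂ) * ((√(N.choose k) : ℂ) * (((N - k : ℕ) : ℂ) * (Real.cos (s / 2) : ℂ) ^ (N - k - 1) *
          (-(Real.sin (s / 2) : ℂ) / 2) * (-Complex.I * (Real.sin (s / 2) : ℂ)) ^ k +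
        (Real.cos (s / 2) : ℂ) ^ (N - k) *
          ((k : ℂ) * (-Complex.I * (Real.sin (s / 2) : ℂ)) ^ (k - 1) *
            (-Complex.I * ((Real.cos (s / 2) : ℂ) / 2))))) =
    -Complex.I * ∑ j ∈ Finset.range (N + 2), chainEntry N r c k j • coherentAmplitude N s j := by
  rw [sum_chainEntry_smul N r c _ k hk]
  set C : ℂ := (Real.cos (s / 2) : ℂ)
  set S : ℂ := (Real.sin (s / 2) : ℂ)
  have hI := Complex.I_mul_I
  have hcoh : ∀ j, coherentAmplitude N s j
      = (√(N.choose j) : ℂ) * (C ^ (N - j) * (-Complex.I * S) ^ j) := fun _ => rfl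
  rcases Nat.lt_or_ge N k with h1 | h1
  · have : k = N + 1 := by omega
    subst this
    simp [coherentAmplitude]
  · have e1 : k ≠ N + 1 := by omega
    simp only [h1, e1, if_false, add_zero, and_true]
    have f1 : (if k < N then (r * krawtchoukCoupling N k) • coherentAmplitude N s (k + 1) else 0)
        = (r : ℂ) * (((N - k : ℕ) : ℂ) / 2 * √(N.choose k) *
          (C ^ (N - k - 1) * (-Complex.I * S) ^ (k + 1))) := by
      split_ifs with h2
      · have h := congrArg (fun x : ℝ => (x : ℂ)) (krawtchoukCoupling_mul_sqrt_choose_succ N k)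
        push_cast at h
        rw [Complex.real_smul, hcoh, Nat.sub_sub, Complex.ofReal_mul]
        linear_combination (r : ℂ) * (C ^ (N - (k + 1)) * (-Complex.I * S) ^ (k + 1)) * h
      · have : k = N := by omega
        simp [this]
    have f2 : (if 0 < k then (r * krawtchoukCoupling N (k - 1)) • coherentAmplitude N s (k - 1)
          else 0)
        = (r : ℂ) * ((k : ℂ) / 2 * √(N.choose k) *
          (C ^ (N - k) * C * (-Complex.I * S) ^ (k - 1))) := by
      rcases k with _ | k
      · simp
      · have h := congrArg (fun x : ℝ => (x : ℂ)) (krawtchoukCoupling_mul_sqrt_choose N k)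
        push_cast at h
        simp only [Nat.succ_pos, if_true, Nat.add_sub_cancel]
        rw [Complex.real_smul, hcoh, ← pow_succ, show N - (k + 1) + 1 = N - k by omega,
          Complex.ofReal_mul, Nat.cast_add_one]
        linear_combination (r : ℂ) * (C ^ (N - k) * (-Complex.I * S) ^ k) * h
    rw [f1, f2, pow_succ]
    linear_combination (-(r : ℂ) * ((N - k : ℕ) : ℂ) / 2 * √(N.choose k) *
          C ^ (N - k - 1) * (-Complex.I * S) ^ k * S) * hI

theorem evolution_chainMatrix_mulVec_single (N : ℕ) (r c t : ℝ) :
    evolution (chainMatrix N r c 0 + chainMatrix N r c 1) t *ᵥ Pi.single 0 1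
      = fun k : Fin (N + 2) => coherentAmplitude N (r * t) k := by
  have h := Matrix.exp_smul_mulVec_of_hasDerivAt
    (-Complex.I • (chainMatrix N r c 0 + chainMatrix N r c 1))
    (fun u => fun k : Fin (N + 2) => coherentAmplitude N (r * u) k) (fun u => ?_) t
  · have h0 : (fun k : Fin (N + 2) => coherentAmplitude N (r * 0) k) = Pi.single 0 1 := by
      ext k
      refine Fin.cases ?_ (fun k => ?_) k
      · simp [coherentAmplitude]
      · simp [coherentAmplitude]
    rw [h0] at h
    rw [← h, evolution, ← Complex.coe_smul, smul_smul, mul_comm (t : ℂ)]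
  · rw [hasDerivAt_pi]
    intro k
    have h1 : HasDerivAt (fun u : ℝ => r * u) r u := by
      simpa using (hasDerivAt_id u).const_mul r
    have h2 := (hasDerivAt_coherentAmplitude N k (r * u)).scomp u h1
    refine h2.congr_deriv ?_
    rw [Complex.real_smul, coherentAmplitude_deriv_eq N k (r * u) k.2 r c, Matrix.smul_mulVec,
      Pi.smul_apply, Matrix.mulVec, dotProduct, smul_eq_mul]
    simp only [chainMatrix_zero_add_one_apply]
    rw [Fin.sum_univ_eq_sum_range
      (fun j => (chainEntry N r c k j : ℂ) * coherentAmplitude N (r * u) j)]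
    simp only [Complex.real_smul]

/-! ### Light cone of the simulated evolution -/

theorem evolution_chainMatrix_mulVec_apply_eq_zero {N : ℕ} {r c : ℝ} (b : Fin 2) (s : ℝ) (m : ℕ)
    (x : Fin (N + 2) → ℂ) (hx : ∀ i : Fin (N + 2), m < i → x i = 0) (i : Fin (N + 2))
    (hi : m + 1 < i) : (evolution (chainMatrix N r c b) s *ᵥ x) i = 0 := by
  -- One of `m`, `m + 1` has the wrong parity to be the left end of an edge in part `b`. Cutting the
  -- path after that site `l` severs no edge of this part, so the projection `P` onto sites up to
  -- `l` commutes with the evolution.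
  obtain ⟨l, hml, hlm, hl⟩ : ∃ l, m ≤ l ∧ l ≤ m + 1 ∧ l % 2 ≠ b := by
    by_cases h : m % 2 = b
    · exact ⟨m + 1, by omega, le_rfl, by omega⟩
    · exact ⟨m, le_rfl, by omega, h⟩
  let P : Matrix (Fin (N + 2)) (Fin (N + 2)) ℂ :=
    Matrix.diagonal fun i => if (i : ℕ) ≤ l then 1 else 0
  have hcomm : Commute P (chainMatrix N r c b) := by
    ext i j
    simp only [P, Matrix.diagonal_mul, Matrix.mul_diagonal]
    by_cases h0 : chainMatrix N r c b i j = 0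
    · simp [h0]
    · have := chainMatrix_apply_ne_zero h0
      split_ifs <;> first | (simp; done) | omega
  have hE : Commute P (evolution (chainMatrix N r c b) s) :=
    (hcomm.smul_right _).exp_right
  have hPx : P *ᵥ x = x := by
    ext j
    rw [Matrix.mulVec_diagonal]
    split_ifs with h
    · simp
    · rw [hx j (by omega), mul_zero]
  rw [← hPx, Matrix.mulVec_mulVec, ← hE.eq, ← Matrix.mulVec_mulVec, Matrix.mulVec_diagonal,
    if_neg (by omega), zero_mul]

theorem prod_evolution_chainMatrix_mulVec_apply_eq_zero {N : ℕ} {r c : ℝ} (t : ℝ)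
    (L : List (Fin 2 × ℝ)) (i : Fin (N + 2)) (hi : L.length < i) :
    ((L.map fun p => evolution (chainMatrix N r c p.1) (p.2 * t)).prod *ᵥ Pi.single 0 1) i = 0 := by
  induction L generalizing i with
  | nil =>
    have : i ≠ 0 := by rintro rfl; simp at hi
    simp [this]
  | cons p L ih =>
    rw [List.map_cons, List.prod_cons, ← Matrix.mulVec_mulVec]
    exact evolution_chainMatrix_mulVec_apply_eq_zero p.1 _ L.length _ ih i (by simpa using hi)

/-! ### The lower bound -/

theorem mainTheorem5 (τ : ℝ) (hτ : Real.arcsin (1 / 4) < τ) (t : ℝ) (ht : 0 < t) :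
    ¬ ∃ S : GeneralIntegrator,
      (S.numExp τ : ℝ) < τ / (2 * Real.pi) ∧
      ∀ (d : ℕ) (H : Fin 2 → Matrix (Fin d) (Fin d) ℂ),
        (∀ j, (H j).IsHermitian) →
        (∀ j, IsOneSparse (H j)) →
        (∀ j, ‖H j‖ ≤ ‖H 0 + H 1‖) →
        ‖H 0 + H 1‖ * t = τ →
        S.ErrorLE (1 / 4) τ t H := by
  rintro ⟨S, hn, hS⟩
  have hπ := Real.pi_pos
  have harc : 0 < Real.arcsin (1 / 4) := Real.arcsin_pos.2 (by norm_num)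
  have hτ0 : 0 < τ := harc.trans hτ
  set n := S.numExp τ with hn_def
  rw [lt_div_iff₀ (by positivity)] at hn
  -- Take `s = π` if the norm budget allows it. Otherwise `τ < π (n + 1) / 2`, which with `2 π n <
  -- τ` forces `n = 0`; then `s = 2 τ` uses the whole budget, and `sin τ > 1/4` since `arcsin (1/4)
  -- < τ < π / 2`.
  obtain ⟨s, hs0, hsτ, hs⟩ : ∃ s : ℝ, 0 ≤ s ∧ s * ((n + 1 : ℕ) : ℝ) / 2 ≤ τ ∧
      1 / 4 < Real.sin (s / 2) ^ (n + 1) := by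
    rcases le_or_gt Real.pi (2 * τ / ((n + 1 : ℕ) : ℝ)) with h | h
    · refine ⟨Real.pi, hπ.le, ?_, by norm_num⟩
      rw [le_div_iff₀ (by positivity)] at h
      linarith
    · rw [div_lt_iff₀ (by positivity)] at h
      have h0 : n = 0 := by
        by_contra h0
        have : (1 : ℝ) ≤ n := by exact_mod_cast Nat.one_le_iff_ne_zero.2 h0
        push_cast at h
        nlinarith
      rw [h0] at h ⊢
      refine ⟨2 * τ, by positivity, by simp, ?_⟩
      norm_num at h ⊢
      have := (Real.arcsin_lt_iff_lt_sin' (x := 1 / 4) (y := τ)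
        ⟨by linarith, by linarith⟩).1 hτ
      simpa using this
  have hrc : s / t * ((n + 1 : ℕ) : ℝ) / 2 ≤ τ / t := by
    rw [div_mul_eq_mul_div, div_right_comm]
    gcongr
  have hr : 0 ≤ s / t := by positivity
  set H := chainMatrix (n + 1) (s / t) (τ / t) with hH
  have hnorm : ‖H 0 + H 1‖ = τ / t := norm_chainMatrix_zero_add_one hr hrc
  have herm : ∀ j, (H j).IsHermitian := chainMatrix_isHermitian _ _ _
  have hE := hS _ H herm (chainMatrix_isOneSparse _ _ _)
    (fun j => (norm_chainMatrix_le hr hrc j).trans hnorm.ge)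
    (by rw [hnorm]; field_simp) (EuclideanSpace.single 0 1) (by simp)
  rw [finalState_eq_vecMulVec, finalState_eq_vecMulVec] at hE
  have hU : S.simulation τ t H ∈ unitary (Matrix (Fin (n + 1 + 2)) (Fin (n + 1 + 2)) ℂ) := by
    refine Submonoid.list_prod_mem _ fun x hx => ?_
    obtain ⟨p, -, rfl⟩ := List.mem_map.1 hx
    exact evolution_mem_unitary (herm p.1) _
  have hV := evolution_mem_unitary ((herm 0).add (herm 1)) t
  set x : EuclideanSpace ℂ (Fin (n + 1 + 2)) := WithLp.toLp 2
    (S.simulation τ t H *ᵥ (EuclideanSpace.single 0 1 : EuclideanSpace ℂ (Fin (n + 1 + 2))).ofLp)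
    with hx
  set y : EuclideanSpace ℂ (Fin (n + 1 + 2)) := WithLp.toLp 2
    (evolution (H 0 + H 1) t *ᵥ
      (EuclideanSpace.single 0 1 : EuclideanSpace ℂ (Fin (n + 1 + 2))).ofLp) with hy
  have hx1 : ‖x‖ = 1 := by rw [hx, norm_toLp_mulVec_of_mem_unitary hU]; simp
  have hy1 : ‖y‖ = 1 := by rw [hy, norm_toLp_mulVec_of_mem_unitary hV]; simp
  let k : Fin (n + 1 + 2) := ⟨n + 1, by omega⟩
  -- Site `n + 1` is the first one out of reach of `n` exponentials and the last one of the coupled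
  -- chain.
  have hxk : x k = 0 :=
    prod_evolution_chainMatrix_mulVec_apply_eq_zero t (S τ) k (Nat.lt_succ_self n)
  have hyk : ‖y k‖ = |Real.sin (s / 2)| ^ (n + 1) := by
    have h : y k = coherentAmplitude (n + 1) (s / t * t) k :=
      congrFun (evolution_chainMatrix_mulVec_single (n + 1) (s / t) (τ / t) t) k
    rw [h, div_mul_cancel₀ _ ht.ne', coherentAmplitude]
    simp [k, -Complex.ofReal_sin]
  have hz : 1 / 4 < ‖y k‖ := by
    rw [hyk, ← abs_pow]
    exact hs.trans_le (le_abs_self _)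
  have hF := norm_inner_sq_le_of_apply_eq_zero x y hx1 hy1 k hxk
  have hF1 : ‖inner ℂ x y‖ < 1 := by
    rw [← sq_lt_one_iff₀ (norm_nonneg _)]
    nlinarith
  have hD := traceDistance_vecMulVec x y hx1 hy1 hF1
  have hle : ‖y k‖ ≤ √(1 - ‖inner ℂ x y‖ ^ 2) := Real.le_sqrt_of_sq_le (by linarith)
  rw [← hD] at hle
  exact absurd (hle.trans hE) (not_le.2 hz)
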